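/- Work with coordinates $(x,y_1,y_2)$ on $(\mathbb C^3,0)$. A formal diffeomorphism $\Phi$ is a triple of formal power series in $\mathbb C[[x,y_1,y_2]]$ without constant term whose linear part is invertible; formal diffeomorphisms form a group under composition, act on formal vector fields by $\Phi_*(Y)=(\mathrm D\Phi\cdot Y)\circ\Phi^{-1}$, and act on formal differential forms by pull-back. Let $\omega=\frac{\mathrm dy_1\wedge \mathrm dy_2}{x}$ and let $\langle \mathrm dx\rangle$ be the set of formal differential forms $\mathrm dx\wedge\eta$. Call $\Phi$ transversally symplectic if $\Phi^*(x)=x$ and $x\,\Phi^*(\omega)\in x\,\omega+\langle \mathrm dx\rangle$, where $\Phi^*(\theta/x)=\Phi^*(\theta)/x$ for formal forms $\theta$, so that $x\,\Phi^*(\omega)=\Phi^*(\mathrm dy_1\wedge \mathrm dy_2)$; these $\Phi$ form a group. For a formal vector field $Z$ let $\widehat{\mathrm{Isot}}_\omega(Z)$ be the group of transversally symplectic formal diffeomorphisms $\Phi$ with $\Phi_*(Z)=Z$. Proposition. Let $\lambda\in\mathbb C\setminus\{0\}$ and $a_1,a_2\in\mathbb C$ with $a_1+a_2=1$, let $c\in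 v\,\mathbb C[[v]]$ be a formal power series without constant term, and, with $v=y_1y_2$, let $$Z=x^2\frac{\partial}{\partial x}+\bigl(-(\lambda+c(v))+a_1x\bigr)y_1\frac{\partial}{\partial y_1}+\bigl(\lambda+c(v)+a_2x\bigr)y_2\frac{\partial}{\partial y_2}.$$ Then $$\widehat{\mathrm{Isot}}_\omega(Z)=\Bigl\{\operatorname{diag}\bigl(1,\alpha,\tfrac1\alpha\bigr):\alpha\in\mathbb C\setminus\{0\}\Bigr\},$$ where $\operatorname{diag}(1,\alpha,\frac1\alpha)$ denotes $(x,y_1,y_2)\mapsto(x,\alpha y_1,\alpha^{-1}y_2)$, and $\alpha\mapsto\operatorname{diag}(1,\alpha,\frac1\alpha)$ is a group isomorphism from the multiplicative group $\mathbb C\setminus\{0\}$ onto $\widehat{\mathrm{Isot}}_\omega(Z)$. -/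

import Mathlib

open scoped Matrix

namespace FormalGeometry

open MvPowerSeries

/-! ### Formal power series in `n` variables over `ℂ`: auxiliary facts -/

/-- The algebra `ℂ⟦x₁, …, xₙ⟧` of formal power series. -/
abbrev Series (n : ℕ) : Type := MvPowerSeries (Fin n) ℂ

section Aux

variable {n : ℕ}

theorem hasSubst {a : Fin n → Series n} (ha : ∀ i, constantCoeff (a i) = 0) : HasSubst a :=
  hasSubst_of_constantCoeff_zero ha

theorem constantCoeff_subst' {a : Fin n → Series n} (ha : ∀ i, constantCoeff (a i) = 0)
    (f : Series n) : constantCoeff (subst a f) = constantCoeff f := by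
  have h : f = C (constantCoeff f) + (f - C (constantCoeff f)) := by ring
  have h0 : constantCoeff (f - C (constantCoeff f)) = 0 := by simp
  rw [h, subst_add (hasSubst ha), map_add, constantCoeff_subst_eq_zero (hasSubst ha) ha h0,
    subst_C]
  simp

theorem order_subst_ge {a : Fin n → Series n} (ha : ∀ i, constantCoeff (a i) = 0)
    {f : Series n} {k : ℕ} (hf : (k : ℕ∞) ≤ f.order) : (k : ℕ∞) ≤ (subst a f).order := by
  refine le_trans ?_ (le_order_subst (hasSubst ha) f)
  have h1 : (1 : ℕ∞) ≤ ⨅ i, (a i).order :=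
    le_iInf fun i => (one_le_order_iff_constCoeff_eq_zero).2 (ha i)
  calc (k : ℕ∞) = 1 * k := by simp
    _ ≤ _ := mul_le_mul' h1 hf

theorem order_pderiv_ge {f : Series n} {k : ℕ} (hf : ((k + 1 : ℕ) : ℕ∞) ≤ f.order) (j : Fin n) :
    (k : ℕ∞) ≤ (pderiv ℂ j f).order := by
  refine nat_le_order fun d hd => ?_
  rw [coeff_pderiv, coeff_of_lt_order, zero_mul]
  refine lt_of_lt_of_le ?_ hf
  simpa using hd

theorem chain_rule_poly {a : Fin n → Series n} (ha : ∀ i, constantCoeff (a i) = 0)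
    (p : MvPolynomial (Fin n) ℂ) (j : Fin n) :
    pderiv ℂ j (subst a (p : Series n)) =
      ∑ k, subst a (pderiv ℂ k (p : Series n)) * pderiv ℂ j (a k) := by
  induction p using MvPolynomial.induction_on with
  | C c =>
    rw [MvPolynomial.coe_C, subst_C, pderiv_C]
    symm
    refine Finset.sum_eq_zero fun k _ => ?_
    rw [pderiv_C, ← substAlgHom_apply (hasSubst ha), map_zero, zero_mul]
  | add p q hp hq =>
    simp only [MvPolynomial.coe_add, subst_add (hasSubst ha), map_add, hp, hq, add_mul,
      Finset.sum_add_distrib]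
  | mul_X p i hp =>
    simp only [MvPolynomial.coe_mul, MvPolynomial.coe_X, subst_mul (hasSubst ha),
      Derivation.leibniz, hp, smul_eq_mul, subst_add (hasSubst ha), subst_X (hasSubst ha),
      add_mul, Finset.sum_add_distrib]
    congr 1
    · rw [Finset.sum_eq_single i]
      · rw [pderiv_X_self]
        have : subst a (1 : Series n) = 1 := by
          rw [← substAlgHom_apply (hasSubst ha), map_one]
        rw [this, mul_one]
      · intro k _ hk
        have : subst a (0 : Series n) = 0 := by
          rw [← substAlgHom_apply (hasSubst ha), map_zero]
        rw [pderiv_X_of_ne hk.symm, this]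
        ring
      · simp
    · rw [Finset.mul_sum]
      exact Finset.sum_congr rfl fun k _ => by ring

theorem chain_rule {a : Fin n → Series n} (ha : ∀ i, constantCoeff (a i) = 0)
    (f : Series n) (j : Fin n) :
    pderiv ℂ j (subst a f) = ∑ k, subst a (pderiv ℂ k f) * pderiv ℂ j (a k) := by
  ext e
  set N := e.degree + 2 with hN
  set p := truncTotal N f with hp
  set g := f - (p : Series n) with hg
  have hgo : (N : ℕ∞) ≤ g.order := by
    refine nat_le_order fun d hd => ?_
    rw [hg, map_sub, MvPolynomial.coeff_coe, coeff_truncTotal _ hd, sub_self]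
  have hf : f = (p : Series n) + g := by rw [hg]; ring
  have h1 : coeff e (pderiv ℂ j (subst a g)) = 0 := by
    refine coeff_of_lt_order (lt_of_lt_of_le ?_
      (order_pderiv_ge (k := e.degree + 1) (order_subst_ge ha hgo) j))
    exact_mod_cast Nat.lt_succ_self _
  have h2 : ∀ k, coeff e (subst a (pderiv ℂ k g) * pderiv ℂ j (a k)) = 0 := by
    intro k
    refine coeff_of_lt_order (lt_of_lt_of_le ?_ ((le_add_of_nonneg_right (zero_le)).trans
      ((add_le_add_left (order_subst_ge ha
        (order_pderiv_ge (k := e.degree + 1) hgo k)) _).trans le_order_mul)))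
    exact_mod_cast Nat.lt_succ_self _
  rw [hf]
  simp only [subst_add (hasSubst ha), map_add, add_mul, Finset.sum_add_distrib]
  rw [h1, chain_rule_poly ha p j, map_sum, map_sum, Finset.sum_eq_zero fun k _ => h2 k]

/-- The linear part of a tuple of series: the matrix of its first partial derivatives at `0`. -/
noncomputable def linearPart (a : Fin n → Series n) : Matrix (Fin n) (Fin n) ℂ :=
  Matrix.of fun i j => constantCoeff (pderiv ℂ j (a i))

theorem linearPart_subst {a : Fin n → Series n} (ha : ∀ i, constantCoeff (a i) = 0)
    (b : Fin n → Series n) :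
    linearPart (fun i => subst a (b i)) = linearPart b * linearPart a := by
  ext i j
  simp only [linearPart, Matrix.of_apply, Matrix.mul_apply, chain_rule ha, map_sum, map_mul,
    constantCoeff_subst' ha]

theorem order_ge_of_pderiv {f : Series n} {k : ℕ} (h0 : constantCoeff f = 0)
    (h : ∀ j, (k : ℕ∞) ≤ (pderiv ℂ j f).order) : ((k + 1 : ℕ) : ℕ∞) ≤ f.order := by
  classical
  refine nat_le_order fun d hd => ?_
  by_cases hd0 : d = 0
  · rw [hd0, coeff_zero_eq_constantCoeff_apply, h0]
  obtain ⟨j, hj⟩ : ∃ j, d j ≠ 0 := by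
    by_contra! hc
    exact hd0 (Finsupp.ext hc)
  have hle : Finsupp.single j 1 ≤ d := by
    rw [Finsupp.single_le_iff]; omega
  obtain ⟨e, rfl⟩ := exists_add_of_le hle
  rw [add_comm] at *
  have h1 : coeff e (pderiv ℂ j f) = 0 := by
    refine coeff_of_lt_order (lt_of_lt_of_le ?_ (h j))
    have : e.degree + 1 < k + 1 := by simpa [add_comm] using hd
    exact_mod_cast Nat.lt_of_succ_lt_succ this
  rw [coeff_pderiv] at h1
  exact (mul_eq_zero.1 h1).resolve_right (Nat.cast_add_one_ne_zero (e j))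

/-- Substituting a tuple tangent to the identity changes a series only in higher order. -/
theorem order_sub_subst {a : Fin n → Series n} (ha : ∀ i, constantCoeff (a i) = 0)
    (hl : linearPart a = 1) (k : ℕ) (f : Series n) (hf : (k : ℕ∞) ≤ f.order) :
    ((k + 1 : ℕ) : ℕ∞) ≤ (f - subst a f).order := by
  classical
  induction k generalizing f with
  | zero =>
    have : constantCoeff (f - subst a f) = 0 := by
      rw [map_sub, constantCoeff_subst' ha, sub_self]
    simpa using (one_le_order_iff_constCoeff_eq_zero).2 this
  | succ k ih =>
    refine order_ge_of_pderiv (by rw [map_sub, constantCoeff_subst' ha, sub_self]) fun j => ?_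
    have key : pderiv ℂ j (f - subst a f) =
        ∑ i, ((pderiv ℂ i f - subst a (pderiv ℂ i f)) * pderiv ℂ j (a i) +
          pderiv ℂ i f * ((if i = j then 1 else 0) - pderiv ℂ j (a i))) := by
      rw [map_sub, chain_rule ha]
      have : pderiv ℂ j f = ∑ i, pderiv ℂ i f * (if i = j then 1 else 0) := by simp
      nth_rewrite 1 [this]
      rw [← Finset.sum_sub_distrib]
      exact Finset.sum_congr rfl fun i _ => by ring
    rw [key]
    refine nat_le_order fun d hd => ?_
    rw [map_sum]
    refine Finset.sum_eq_zero fun i _ => ?_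
    have hi : (k : ℕ∞) ≤ (pderiv ℂ i f).order := order_pderiv_ge hf i
    have hdd : ((d.degree : ℕ) : ℕ∞) < ((k + 1 : ℕ) : ℕ∞) := by exact_mod_cast hd
    rw [map_add, coeff_of_lt_order, coeff_of_lt_order, add_zero]
    · refine lt_of_lt_of_le hdd (le_trans ?_ le_order_mul)
      have h1 : (1 : ℕ∞) ≤
          ((if i = j then (1 : Series n) else 0) - pderiv ℂ j (a i)).order := by
        refine (one_le_order_iff_constCoeff_eq_zero).2 ?_
        have := congrFun (congrFun hl i) j
        simp only [linearPart, Matrix.of_apply, Matrix.one_apply] at this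
        rw [map_sub, this]
        split_ifs <;> simp
      push_cast
      exact add_le_add hi h1
    · refine lt_of_lt_of_le hdd (le_trans ?_ le_order_mul)
      exact le_add_of_le_of_nonneg (ih _ hi) zero_le

/-- Substitution of a tuple tangent to the identity is onto. -/
theorem exists_subst_eq {a : Fin n → Series n} (ha : ∀ i, constantCoeff (a i) = 0)
    (hl : linearPart a = 1) (f : Series n) : ∃ g : Series n, subst a g = f := by
  classical
  set M : Series n → Series n := fun g => g - subst a g with hM
  have hMo : ∀ k : ℕ, (k : ℕ∞) ≤ (M^[k] f).order := by
    intro k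
    induction k with
    | zero => simp
    | succ k ih =>
      rw [Function.iterate_succ_apply']
      exact order_sub_subst ha hl k _ ih
  set S : Series n := fun d => ∑ k ∈ Finset.range (d.degree + 1), coeff d (M^[k] f) with hS
  have hSc : ∀ d, coeff d S = ∑ k ∈ Finset.range (d.degree + 1), coeff d (M^[k] f) :=
    fun d => rfl
  refine ⟨S, ?_⟩
  ext d
  set N := d.degree + 1 with hN
  set P : Series n := ∑ k ∈ Finset.range N, M^[k] f with hP
  have hSP : (N : ℕ∞) ≤ (S - P).order := by
    refine nat_le_order fun e he => ?_
    rw [map_sub, hSc, hP, map_sum, sub_eq_zero]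
    refine Finset.sum_subset (Finset.range_mono (by omega)) fun k _ hk => ?_
    refine coeff_of_lt_order (lt_of_lt_of_le ?_ (hMo k))
    have : e.degree < k := by simpa using hk
    exact_mod_cast this
  have hlt : ((d.degree : ℕ) : ℕ∞) < (N : ℕ∞) := by exact_mod_cast Nat.lt_succ_self _
  have h1 : coeff d (subst a S) = coeff d (subst a P) := by
    have := coeff_of_lt_order (lt_of_lt_of_le hlt (order_subst_ge ha hSP))
    rw [subst_sub (hasSubst ha), map_sub, sub_eq_zero] at this
    exact this
  have h2 : subst a P = f - M^[N] f := by
    have hT : ∀ g, subst a g = g - M g := fun g => by simp [hM]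
    have : subst a P = ∑ k ∈ Finset.range N, (M^[k] f - M^[k + 1] f) := by
      rw [hP, ← substAlgHom_apply (hasSubst ha), map_sum]
      refine Finset.sum_congr rfl fun k _ => ?_
      rw [substAlgHom_apply, hT, Function.iterate_succ_apply']
    rw [this, Finset.sum_range_sub']
    rfl
  rw [h1, h2, map_sub, coeff_of_lt_order (lt_of_lt_of_le hlt (hMo N)), sub_zero]

end Aux

/-! ### Formal diffeomorphisms -/

/-- A formal diffeomorphism of `(ℂⁿ, 0)`: an `n`-tuple of formal power series without constant
term whose linear part is invertible. -/
@[ext]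
structure FormalDiffeo (n : ℕ) where
  /-- the components `Φ(x₁), …, Φ(xₙ)` -/
  comp : Fin n → Series n
  constantCoeff_comp : ∀ i, constantCoeff (comp i) = 0
  isUnit_linearPart : IsUnit (linearPart comp)

namespace FormalDiffeo

variable {n : ℕ}

theorem hasSubst_comp (Φ : FormalDiffeo n) : HasSubst Φ.comp :=
  hasSubst Φ.constantCoeff_comp

/-- The pull-back `Φ^*` on formal power series, `f ↦ f ∘ Φ`. -/
noncomputable def pullbackSeries (Φ : FormalDiffeo n) : Series n →ₐ[ℂ] Series n :=
  substAlgHom Φ.hasSubst_comp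

theorem pullbackSeries_apply (Φ : FormalDiffeo n) (f : Series n) :
    Φ.pullbackSeries f = subst Φ.comp f := substAlgHom_apply _ f

@[simp]
theorem pullbackSeries_X (Φ : FormalDiffeo n) (i : Fin n) :
    Φ.pullbackSeries (X i) = Φ.comp i := substAlgHom_X _ i

theorem pderiv_pullbackSeries (Φ : FormalDiffeo n) (f : Series n) (j : Fin n) :
    pderiv ℂ j (Φ.pullbackSeries f) =
      ∑ k, Φ.pullbackSeries (pderiv ℂ k f) * pderiv ℂ j (Φ.comp k) := by
  simp only [pullbackSeries_apply]
  exact chain_rule Φ.constantCoeff_comp f j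

theorem linearPart_X : linearPart (X : Fin n → Series n) = 1 := by
  classical
  ext i j
  simp only [linearPart, Matrix.of_apply, pderiv_X, Matrix.one_apply, Pi.single_apply]
  split_ifs <;> simp

/-- The identity. -/
noncomputable instance : One (FormalDiffeo n) where
  one := ⟨X, fun i => by simp, by rw [linearPart_X]; exact isUnit_one⟩

/-- The product is composition: `(Φ * Ψ)(x) = Φ(Ψ(x))`. -/
noncomputable instance : Mul (FormalDiffeo n) where
  mul Φ Ψ := ⟨fun i => Ψ.pullbackSeries (Φ.comp i),
    fun i => by
      rw [pullbackSeries_apply, constantCoeff_subst' Ψ.constantCoeff_comp, Φ.constantCoeff_comp],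
    by
      simp only [pullbackSeries_apply]
      rw [linearPart_subst Ψ.constantCoeff_comp]
      exact Φ.isUnit_linearPart.mul Ψ.isUnit_linearPart⟩

theorem one_comp (i : Fin n) : (1 : FormalDiffeo n).comp i = X i := rfl

theorem mul_comp (Φ Ψ : FormalDiffeo n) (i : Fin n) :
    (Φ * Ψ).comp i = Ψ.pullbackSeries (Φ.comp i) := rfl

theorem pullbackSeries_one (f : Series n) : (1 : FormalDiffeo n).pullbackSeries f = f := by
  rw [pullbackSeries_apply]
  exact congrFun subst_self f

theorem pullbackSeries_mul (Φ Ψ : FormalDiffeo n) (f : Series n) :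
    (Φ * Ψ).pullbackSeries f = Ψ.pullbackSeries (Φ.pullbackSeries f) := by
  simp only [pullbackSeries_apply]
  rw [subst_comp_subst_apply Φ.hasSubst_comp Ψ.hasSubst_comp]
  congr 1
  funext i
  rw [mul_comp, pullbackSeries_apply]

/-- The invertible linear map with matrix `A`, as a formal diffeomorphism. -/
noncomputable def linear (A : Matrix (Fin n) (Fin n) ℂ) (hA : IsUnit A) : FormalDiffeo n where
  comp i := ∑ j, C (A i j) * X j
  constantCoeff_comp i := by simp [map_sum]
  isUnit_linearPart := by
    classical
    convert hA
    ext i j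
    simp only [linearPart, Matrix.of_apply, map_sum, Derivation.leibniz, pderiv_C, smul_zero,
      add_zero, smul_eq_mul, map_mul, constantCoeff_C, pderiv_X, Pi.single_apply]
    simp [apply_ite]

theorem linearPart_linear (A : Matrix (Fin n) (Fin n) ℂ) (hA : IsUnit A) :
    linearPart (linear A hA).comp = A := by
  classical
  ext i j
  simp only [linear, linearPart, Matrix.of_apply, map_sum, Derivation.leibniz, pderiv_C, smul_zero,
    add_zero, smul_eq_mul, map_mul, constantCoeff_C, pderiv_X, Pi.single_apply]
  simp [apply_ite]

protected theorem mul_assoc (Φ Ψ Θ : FormalDiffeo n) : Φ * Ψ * Θ = Φ * (Ψ * Θ) := by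
  ext1
  funext i
  rw [mul_comp, mul_comp, mul_comp, pullbackSeries_mul]

protected theorem one_mul (Φ : FormalDiffeo n) : 1 * Φ = Φ := by
  ext1
  funext i
  rw [mul_comp, one_comp, pullbackSeries_X]

/-- The formal inverse function theorem. -/
theorem exists_left_inv (Φ : FormalDiffeo n) : ∃ Ψ : FormalDiffeo n, Ψ * Φ = 1 := by
  classical
  obtain ⟨B, hB⟩ := Φ.isUnit_linearPart.exists_left_inv
  have hBu : IsUnit B := IsUnit.of_mul_eq_one _ hB
  set Φ' : FormalDiffeo n := linear B hBu * Φ with hΦ'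
  have hl : linearPart Φ'.comp = 1 := by
    have : Φ'.comp = fun i => subst Φ.comp ((linear B hBu).comp i) := by
      funext i; rw [hΦ', mul_comp, pullbackSeries_apply]
    rw [this, linearPart_subst Φ.constantCoeff_comp, linearPart_linear, hB]
  choose g hg using fun i => exists_subst_eq Φ'.constantCoeff_comp hl (X i : Series n)
  have hg0 : ∀ i, constantCoeff (g i) = 0 := fun i => by
    rw [← constantCoeff_subst' Φ'.constantCoeff_comp, hg]; simp
  have hgl : linearPart g = 1 := by
    have := linearPart_subst Φ'.constantCoeff_comp g
    rw [hl, Matrix.mul_one] at this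
    rw [← this, ← linearPart_X]
    congr 1
    funext i
    exact hg i
  refine ⟨⟨g, hg0, hgl ▸ isUnit_one⟩ * linear B hBu, ?_⟩
  rw [FormalDiffeo.mul_assoc, ← hΦ']
  ext1
  funext i
  rw [mul_comp, pullbackSeries_apply]
  exact hg i

noncomputable instance : Inv (FormalDiffeo n) where
  inv Φ := Φ.exists_left_inv.choose

/-- The group of formal diffeomorphisms of `(ℂⁿ, 0)` under composition. -/
noncomputable instance : Group (FormalDiffeo n) :=
  Group.ofLeftAxioms FormalDiffeo.mul_assoc FormalDiffeo.one_mul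
    fun Φ => Φ.exists_left_inv.choose_spec

/-- The diagonal linear diffeomorphism `diag(d₁, …, dₙ) : x ↦ (d₁ x₁, …, dₙ xₙ)`. -/
noncomputable def diag (d : Fin n → ℂˣ) : FormalDiffeo n where
  comp i := C (d i : ℂ) * X i
  constantCoeff_comp i := by simp
  isUnit_linearPart := by
    classical
    have : linearPart (fun i => C (d i : ℂ) * X i : Fin n → Series n) =
        Matrix.diagonal fun i => (d i : ℂ) := by
      ext i j
      simp only [linearPart, Matrix.of_apply, Derivation.leibniz, pderiv_C, smul_zero,
        add_zero, smul_eq_mul, map_mul, constantCoeff_C, pderiv_X, Pi.single_apply,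
        Matrix.diagonal_apply]
      split_ifs <;> simp
    rw [this, Matrix.isUnit_diagonal, Pi.isUnit_iff]
    exact fun i => (d i).isUnit

end FormalDiffeo

/-! ### Formal vector fields -/

/-- A formal vector field `∑ᵢ Yᵢ ∂/∂xᵢ`, given by its components. -/
abbrev VectorField (n : ℕ) : Type := Fin n → Series n

/-- The push-forward `Φ_*(Y) = (DΦ · Y) ∘ Φ⁻¹`. -/
noncomputable def pushForward {n : ℕ} (Φ : FormalDiffeo n) (Y : VectorField n) : VectorField n :=
  fun i => (Φ⁻¹).pullbackSeries (∑ j, pderiv ℂ j (Φ.comp i) * Y j)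

theorem pushForward_one {n : ℕ} (Y : VectorField n) : pushForward 1 Y = Y := by
  classical
  funext i
  simp only [pushForward, inv_one, FormalDiffeo.pullbackSeries_one, FormalDiffeo.one_comp,
    pderiv_X, Pi.single_apply]
  simp

theorem pushForward_mul {n : ℕ} (Φ Ψ : FormalDiffeo n) (Y : VectorField n) :
    pushForward (Φ * Ψ) Y = pushForward Φ (pushForward Ψ Y) := by
  funext i
  have hinv : ∀ f : Series n, (Ψ⁻¹).pullbackSeries (Ψ.pullbackSeries f) = f := fun f => by
    rw [← FormalDiffeo.pullbackSeries_mul, mul_inv_cancel, FormalDiffeo.pullbackSeries_one]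
  simp only [pushForward, mul_inv_rev, FormalDiffeo.pullbackSeries_mul, FormalDiffeo.mul_comp,
    FormalDiffeo.pderiv_pullbackSeries]
  congr 1
  have : ∑ j, (∑ k, Ψ.pullbackSeries (pderiv ℂ k (Φ.comp i)) * pderiv ℂ j (Ψ.comp k)) * Y j =
      ∑ k, Ψ.pullbackSeries (pderiv ℂ k (Φ.comp i)) * ∑ j, pderiv ℂ j (Ψ.comp k) * Y j := by
    simp only [Finset.sum_mul, Finset.mul_sum]
    rw [Finset.sum_comm]
    exact Finset.sum_congr rfl fun _ _ => Finset.sum_congr rfl fun _ _ => by ring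
  rw [this, map_sum]
  exact Finset.sum_congr rfl fun k _ => by rw [map_mul, hinv]

/-! ### Formal differential forms -/

/-- Formal `1`-forms `∑ᵢ vᵢ dxᵢ`, given by their coefficients. -/
abbrev OneForm (n : ℕ) : Type := Fin n → Series n

/-- The exterior algebra of formal differential forms, with `*` as the wedge product. -/
abbrev Form (n : ℕ) : Type := ExteriorAlgebra (Series n) (OneForm n)

/-- The differential `df = ∑ᵢ (∂f/∂xᵢ) dxᵢ` of a formal power series, as a form. -/
noncomputable def dSeries {n : ℕ} (f : Series n) : Form n :=
  ExteriorAlgebra.ι (Series n) (fun i => pderiv ℂ i f : OneForm n)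

/-- Pull-back of `1`-forms: `Φ^*(∑ⱼ vⱼ dxⱼ) = ∑ⱼ (vⱼ ∘ Φ) dΦⱼ`. -/
noncomputable def pullbackOneForm {n : ℕ} (Φ : FormalDiffeo n) (v : OneForm n) : OneForm n :=
  fun i => ∑ j, Φ.pullbackSeries (v j) * pderiv ℂ i (Φ.comp j)

/-- The ring of forms, on which a series `f` acts as multiplication by `f ∘ Φ`. -/
def TwistedForm {n : ℕ} (_Φ : FormalDiffeo n) : Type := Form n

noncomputable instance {n : ℕ} (Φ : FormalDiffeo n) : Ring (TwistedForm Φ) :=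
  inferInstanceAs (Ring (Form n))

noncomputable instance {n : ℕ} (Φ : FormalDiffeo n) : Algebra (Series n) (TwistedForm Φ) :=
  RingHom.toAlgebra'
    ((algebraMap (Series n) (Form n)).comp (Φ.pullbackSeries : Series n →+* Series n))
    (fun f θ => Algebra.commutes (A := Form n) (Φ.pullbackSeries f) θ)

/-- Pull-back of `1`-forms, as a linear map to the twisted ring of forms. -/
noncomputable def pullbackLinear {n : ℕ} (Φ : FormalDiffeo n) :
    OneForm n →ₗ[Series n] TwistedForm Φ where
  toFun v := (ExteriorAlgebra.ι (Series n) (pullbackOneForm Φ v) : Form n)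
  map_add' v w := by
    have h : pullbackOneForm Φ (v + w) = pullbackOneForm Φ v + pullbackOneForm Φ w := by
      funext i
      simp [pullbackOneForm, add_mul, Finset.sum_add_distrib]
    rw [h, map_add]
    rfl
  map_smul' f v := by
    have h : pullbackOneForm Φ (f • v) = Φ.pullbackSeries f • pullbackOneForm Φ v := by
      funext i
      simp [pullbackOneForm, Finset.mul_sum, mul_assoc]
    rw [h, map_smul, Algebra.smul_def]
    rfl

/-- Pull-back of formal differential forms: the ring endomorphism of the exterior algebra that is
`f ↦ f ∘ Φ` on series and `pullbackOneForm Φ` on `1`-forms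
(see `pullback_algebraMap` and `pullback_ι`). -/
noncomputable def pullback {n : ℕ} (Φ : FormalDiffeo n) : Form n →+* Form n :=
  (ExteriorAlgebra.lift (Series n) (A := TwistedForm Φ)
    ⟨pullbackLinear Φ, fun v => ExteriorAlgebra.ι_sq_zero (pullbackOneForm Φ v)⟩).toRingHom

theorem pullback_algebraMap {n : ℕ} (Φ : FormalDiffeo n) (f : Series n) :
    pullback Φ (algebraMap (Series n) (Form n) f) =
      algebraMap (Series n) (Form n) (Φ.pullbackSeries f) :=
  (ExteriorAlgebra.lift (Series n) (A := TwistedForm Φ)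
    ⟨pullbackLinear Φ, fun v => ExteriorAlgebra.ι_sq_zero (pullbackOneForm Φ v)⟩).commutes f

theorem pullback_ι {n : ℕ} (Φ : FormalDiffeo n) (v : OneForm n) :
    pullback Φ (ExteriorAlgebra.ι (Series n) v) =
      ExteriorAlgebra.ι (Series n) (pullbackOneForm Φ v) :=
  ExteriorAlgebra.lift_ι_apply (Series n) (A := TwistedForm Φ) (pullbackLinear Φ) _ v

theorem pullback_dSeries {n : ℕ} (Φ : FormalDiffeo n) (f : Series n) :
    pullback Φ (dSeries f) = dSeries (Φ.pullbackSeries f) := by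
  rw [dSeries, pullback_ι, dSeries]
  congr 1
  funext i
  rw [FormalDiffeo.pderiv_pullbackSeries]
  rfl

theorem pullback_one {n : ℕ} (θ : Form n) : pullback 1 θ = θ := by
  classical
  induction θ using ExteriorAlgebra.induction with
  | algebraMap f => rw [pullback_algebraMap, FormalDiffeo.pullbackSeries_one]
  | ι v =>
    rw [pullback_ι]
    congr 1
    funext i
    simp [pullbackOneForm, FormalDiffeo.pullbackSeries_one, FormalDiffeo.one_comp, pderiv_X,
      Pi.single_apply]
  | mul a b ha hb => rw [map_mul, ha, hb]
  | add a b ha hb => rw [map_add, ha, hb]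

theorem pullbackOneForm_mul {n : ℕ} (Φ Ψ : FormalDiffeo n) (v : OneForm n) :
    pullbackOneForm (Φ * Ψ) v = pullbackOneForm Ψ (pullbackOneForm Φ v) := by
  funext i
  simp only [pullbackOneForm, FormalDiffeo.pullbackSeries_mul, FormalDiffeo.mul_comp,
    FormalDiffeo.pderiv_pullbackSeries, map_sum, map_mul, Finset.sum_mul, Finset.mul_sum]
  rw [Finset.sum_comm]
  exact Finset.sum_congr rfl fun _ _ => Finset.sum_congr rfl fun _ _ => by ring

theorem pullback_mul {n : ℕ} (Φ Ψ : FormalDiffeo n) (θ : Form n) :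
    pullback (Φ * Ψ) θ = pullback Ψ (pullback Φ θ) := by
  induction θ using ExteriorAlgebra.induction with
  | algebraMap f =>
    rw [pullback_algebraMap, pullback_algebraMap, pullback_algebraMap,
      FormalDiffeo.pullbackSeries_mul]
  | ι v => rw [pullback_ι, pullback_ι, pullback_ι, pullbackOneForm_mul]
  | mul a b ha hb => rw [map_mul, map_mul, map_mul, ha, hb]
  | add a b ha hb => rw [map_add, map_add, map_add, ha, hb]

/-! ### The transversally symplectic structure on `(ℂ³, 0)`

The coordinates are `(x, y₁, y₂) = (X 0, X 1, X 2)`. -/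

/-- The ideal `⟨dx⟩`: the forms `dx ∧ η`. -/
def MemIdealDx (θ : Form 3) : Prop := ∃ η : Form 3, θ = dSeries (X 0) * η

/-- The `2`-form `dy₁ ∧ dy₂ = x ω`, where `ω = (dy₁ ∧ dy₂) / x`. -/
noncomputable def dy₁dy₂ : Form 3 := dSeries (X 1) * dSeries (X 2)

/-- `Φ` is transversally symplectic with respect to `ω = (dy₁ ∧ dy₂) / x` and `dx`:
`Φ^*(x) = x` and `x Φ^*(ω) ∈ x ω + ⟨dx⟩`. For `Φ` with `Φ^*(x) = x` the pull-back of a form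
`θ / x` is by definition `Φ^*(θ) / x`, so `x Φ^*(ω) = Φ^*(dy₁ ∧ dy₂)`. -/
def IsTransversallySymplectic (Φ : FormalDiffeo 3) : Prop :=
  Φ.pullbackSeries (X 0) = X 0 ∧ MemIdealDx (pullback Φ dy₁dy₂ - dy₁dy₂)

theorem MemIdealDx.pullback {Φ : FormalDiffeo 3} (hΦ : Φ.pullbackSeries (X 0) = X 0)
    {θ : Form 3} (h : MemIdealDx θ) : MemIdealDx (pullback Φ θ) := by
  obtain ⟨η, rfl⟩ := h
  exact ⟨FormalGeometry.pullback Φ η, by rw [map_mul, pullback_dSeries, hΦ]⟩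

/-- The group of transversally symplectic formal diffeomorphisms. -/
noncomputable def transversallySymplecticGroup : Subgroup (FormalDiffeo 3) where
  carrier := {Φ | IsTransversallySymplectic Φ}
  one_mem' := ⟨FormalDiffeo.pullbackSeries_one _, 0, by rw [pullback_one, sub_self, mul_zero]⟩
  mul_mem' {Φ Ψ} hΦ hΨ := by
    refine ⟨by rw [FormalDiffeo.pullbackSeries_mul, hΦ.1, hΨ.1], ?_⟩
    obtain ⟨η₁, h₁⟩ := hΦ.2.pullback hΨ.1
    obtain ⟨η₂, h₂⟩ := hΨ.2
    refine ⟨η₁ + η₂, ?_⟩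
    rw [mul_add, ← h₁, ← h₂, map_sub, pullback_mul]
    abel
  inv_mem' {Φ} hΦ := by
    have h0 : (Φ⁻¹).pullbackSeries (X 0) = X 0 := by
      nth_rewrite 1 [← hΦ.1]
      rw [← FormalDiffeo.pullbackSeries_mul, mul_inv_cancel, FormalDiffeo.pullbackSeries_one]
    refine ⟨h0, ?_⟩
    obtain ⟨η, h⟩ := hΦ.2.pullback h0
    refine ⟨-η, ?_⟩
    rw [mul_neg, ← h, map_sub, ← pullback_mul, mul_inv_cancel, pullback_one]
    abel

/-- The group of transversally symplectic isotropies of `Y`: the transversally symplectic `Φ` with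
`Φ_*(Y) = Y`. -/
noncomputable def isotropyGroup (Y : VectorField 3) : Subgroup (FormalDiffeo 3) where
  carrier := {Φ | Φ ∈ transversallySymplecticGroup ∧ pushForward Φ Y = Y}
  one_mem' := ⟨one_mem _, pushForward_one Y⟩
  mul_mem' {Φ Ψ} hΦ hΨ := ⟨mul_mem hΦ.1 hΨ.1, by rw [pushForward_mul, hΨ.2, hΦ.2]⟩
  inv_mem' {Φ} hΦ := by
    refine ⟨inv_mem hΦ.1, ?_⟩
    nth_rewrite 1 [← hΦ.2]
    rw [← pushForward_mul, inv_mul_cancel, pushForward_one]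

/-- The normal form
`x² ∂/∂x + (-(λ + c(v)) + a₁ x) y₁ ∂/∂y₁ + (λ + c(v) + a₂ x) y₂ ∂/∂y₂`, with `v = y₁ y₂`. -/
noncomputable def normalForm (lam a₁ a₂ : ℂ) (c : PowerSeries ℂ) : VectorField 3 :=
  let x : Series 3 := X 0
  let y₁ : Series 3 := X 1
  let y₂ : Series 3 := X 2
  let cv : Series 3 := PowerSeries.subst (y₁ * y₂) c
  ![x ^ 2, (-(C lam + cv) + C a₁ * x) * y₁, (C lam + cv + C a₂ * x) * y₂]

end FormalGeometry

/-! As a derivation, `Z = (λ + c(v)) H + x E`, where `H = y₂∂₂ - y₁∂₁` and `E = x∂ₓ + a₁y₁∂₁ +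
a₂y₂∂₂` are both diagonal on monomials: `H` multiplies a monomial by its weight `m₂ - m₁`, and `E`
by `m₀ + a₁m₁ + a₂m₂`.

Let `Φ = (x, f, g)` be an isotropy. Then `Z f = (-(λ + c(fg)) + a₁x) f` and `Z g = (λ + c(fg) + a₂x)
g`. In `Z(fg)` the unknown `c(fg)` cancels, and `a₁ + a₂ = 1` leaves `Z(fg) = x fg`. Since `λ ≠ 0`,
an eigen-equation `Z h = (sλ + u) h`, with `u` of weight zero and without constant term, forces `h`
to have weight `s` (`isWeightHomogeneous_of_lieDeriv`). So `fg` has weight `0`; hence so does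
`c(fg)`, and then `f` and `g` have weights `-1` and `1`.

On a homogeneous series `H` is a scalar. Once the `c` terms agree, dividing by `x` leaves an
eigen-equation for `E` (`coeff_of_lieDeriv`). For `fg` it allows only the monomials `x` and `y₁y₂`.
The first is absent because `f` and `g` vanish at `0`; the second has coefficient `1` by the
Jacobian condition (`IsTransversallySymplectic.jacobian`). So `fg = v`, whence `c(fg) = c(v)`, and
the eigen-equations for `f` and `g` leave only `y₁` and `y₂`, with inverse coefficients. -/

namespace FormalGeometry

open MvPowerSeries

/-! ### The weight grading -/

/-- The weight of the monomial `x ^ m₀ * y₁ ^ m₁ * y₂ ^ m₂`: its eigenvalue under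
`y₂ ∂/∂y₂ - y₁ ∂/∂y₁`. -/
def weight (m : Fin 3 →₀ ℕ) : ℤ := m 2 - m 1

theorem weight_add (m e : Fin 3 →₀ ℕ) : weight (m + e) = weight m + weight e := by
  simp only [weight, Finsupp.add_apply]
  push_cast
  ring

/-- `f` is a (possibly infinite) sum of monomials of weight `k`. -/
def IsWeightHomogeneous (k : ℤ) (f : Series 3) : Prop := ∀ m, coeff m f ≠ 0 → weight m = k

namespace IsWeightHomogeneous

variable {j k : ℤ} {f g : Series 3}

theorem coeff_eq_zero (hf : IsWeightHomogeneous k f) {m : Fin 3 →₀ ℕ} (hm : weight m ≠ k) :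
    coeff m f = 0 := by
  by_contra h
  exact hm (hf m h)

theorem one : IsWeightHomogeneous 0 1 := by
  classical
  intro m hm
  rw [coeff_one] at hm
  have : m = 0 := by
    by_contra h
    exact hm (if_neg h)
  simp [this, weight]

theorem X_zero : IsWeightHomogeneous 0 (X 0) := by
  classical
  intro m hm
  rw [coeff_X] at hm
  have : m = Finsupp.single 0 1 := by
    by_contra h
    exact hm (if_neg h)
  simp [this, weight]

theorem X_one : IsWeightHomogeneous (-1) (X 1) := by
  classical
  intro m hm
  rw [coeff_X] at hm
  have : m = Finsupp.single 1 1 := by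
    by_contra h
    exact hm (if_neg h)
  simp [this, weight]

theorem X_two : IsWeightHomogeneous 1 (X 2) := by
  classical
  intro m hm
  rw [coeff_X] at hm
  have : m = Finsupp.single 2 1 := by
    by_contra h
    exact hm (if_neg h)
  simp [this, weight]

theorem add (hf : IsWeightHomogeneous k f) (hg : IsWeightHomogeneous k g) :
    IsWeightHomogeneous k (f + g) := by
  intro m hm
  by_contra h
  exact hm (by rw [map_add, hf.coeff_eq_zero h, hg.coeff_eq_zero h, add_zero])

theorem C_mul (a : ℂ) (hf : IsWeightHomogeneous k f) : IsWeightHomogeneous k (C a * f) := by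
  intro m hm
  by_contra h
  exact hm (by rw [coeff_C_mul, hf.coeff_eq_zero h, mul_zero])

theorem mul (hf : IsWeightHomogeneous j f) (hg : IsWeightHomogeneous k g) :
    IsWeightHomogeneous (j + k) (f * g) := by
  classical
  intro m hm
  rw [coeff_mul] at hm
  obtain ⟨p, hp, hne⟩ := Finset.exists_ne_zero_of_sum_ne_zero hm
  rw [← Finset.HasAntidiagonal.mem_antidiagonal.1 hp, weight_add, hf _ (left_ne_zero_of_mul hne),
    hg _ (right_ne_zero_of_mul hne)]

theorem pow (hf : IsWeightHomogeneous 0 f) (d : ℕ) : IsWeightHomogeneous 0 (f ^ d) := by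
  induction d with
  | zero => simpa using one
  | succ d ih => simpa [pow_succ] using ih.mul hf

theorem subst (hf : IsWeightHomogeneous 0 f) (h0 : constantCoeff f = 0) (c : PowerSeries ℂ) :
    IsWeightHomogeneous 0 (PowerSeries.subst f c) := by
  intro m hm
  by_contra h
  refine hm ?_
  rw [PowerSeries.coeff_subst (PowerSeries.HasSubst.of_constantCoeff_zero h0)]
  refine finsum_eq_zero_of_forall_eq_zero fun d => ?_
  rw [(hf.pow d).coeff_eq_zero h, smul_zero]

end IsWeightHomogeneous

/-- Multiplication by a weight-zero series without constant term raises the degree and keeps the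
weight. -/
theorem coeff_mul_eq_zero_of_lower {u f : Series 3} (hu : IsWeightHomogeneous 0 u)
    (hu0 : constantCoeff u = 0) {m : Fin 3 →₀ ℕ}
    (hf : ∀ e : Fin 3 →₀ ℕ, e.degree < m.degree → weight e = weight m → coeff e f = 0) :
    coeff m (u * f) = 0 := by
  classical
  rw [coeff_mul]
  refine Finset.sum_eq_zero fun p hp => ?_
  by_cases h : coeff p.1 u = 0
  · rw [h, zero_mul]
  have hm : p.1 + p.2 = m := Finset.HasAntidiagonal.mem_antidiagonal.1 hp
  have hp0 : p.1 ≠ 0 := by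
    intro h0
    rw [h0, coeff_zero_eq_constantCoeff_apply] at h
    exact h hu0
  -- A monomial occurring in `u` is nonconstant of weight zero, so the cofactor has smaller degree
  -- and the weight of `m`.
  rw [hf p.2, mul_zero]
  · have : 0 < p.1.degree := by
      rw [Nat.pos_iff_ne_zero]
      simpa [Finsupp.degree_eq_zero_iff] using hp0
    rw [← hm, map_add]
    omega
  · rw [← hm, weight_add, hu _ h, zero_add]

theorem coeff_X_mul_pderiv (i : Fin 3) (f : Series 3) (m : Fin 3 →₀ ℕ) :
    coeff m (X i * pderiv ℂ i f) = m i * coeff m f := by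
  classical
  by_cases h : m i = 0
  · rw [h, Nat.cast_zero, zero_mul, X, coeff_monomial_mul, if_neg]
    rw [Finsupp.single_le_iff]
    omega
  · obtain ⟨e, rfl⟩ := exists_add_of_le (Finsupp.single_le_iff.2 (Nat.one_le_iff_ne_zero.2 h))
    rw [X, coeff_add_monomial_mul, coeff_pderiv, add_comm e]
    simp
    ring

/-! ### Derivation along a vector field -/

/-- The derivative `Y(f)` of a series along a vector field. -/
noncomputable def lieDeriv {n : ℕ} (Y : VectorField n) (f : Series n) : Series n :=
  ∑ j, pderiv ℂ j f * Y j

theorem lieDeriv_mul {n : ℕ} (Y : VectorField n) (f g : Series n) :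
    lieDeriv Y (f * g) = lieDeriv Y f * g + f * lieDeriv Y g := by
  simp only [lieDeriv, Finset.sum_mul, Finset.mul_sum, ← Finset.sum_add_distrib,
    Derivation.leibniz, smul_eq_mul]
  exact Finset.sum_congr rfl fun _ _ => by ring

/-- Composing with `Φ` removes `Φ⁻¹`, so that invariance becomes a differential equation for each
component of `Φ`. -/
theorem pushForward_eq_self_iff {n : ℕ} (Φ : FormalDiffeo n) (Y : VectorField n) :
    pushForward Φ Y = Y ↔ ∀ i, lieDeriv Y (Φ.comp i) = Φ.pullbackSeries (Y i) := by
  rw [funext_iff]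
  refine forall_congr' fun i => ⟨fun h => ?_, fun h => ?_⟩
  · rw [← h, pushForward, ← FormalDiffeo.pullbackSeries_mul, inv_mul_cancel,
      FormalDiffeo.pullbackSeries_one, lieDeriv]
  · rw [pushForward, ← lieDeriv, h, ← FormalDiffeo.pullbackSeries_mul, mul_inv_cancel,
      FormalDiffeo.pullbackSeries_one]

theorem pullbackSeries_powerSeries_subst {n : ℕ} (Φ : FormalDiffeo n) {f : Series n}
    (hf : constantCoeff f = 0) (c : PowerSeries ℂ) :
    Φ.pullbackSeries (PowerSeries.subst f c) = PowerSeries.subst (Φ.pullbackSeries f) c := by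
  rw [FormalDiffeo.pullbackSeries_apply, FormalDiffeo.pullbackSeries_apply,
    PowerSeries.subst_def, PowerSeries.subst_def,
    subst_comp_subst_apply (PowerSeries.HasSubst.of_constantCoeff_zero hf).const Φ.hasSubst_comp]

/-! ### Eigenseries of the normal form -/

section NormalForm

variable {lam a₁ a₂ : ℂ} {c : PowerSeries ℂ}

/-- This grouping separates two operators that are diagonal on monomials; everything apart from the
constant `lam` is multiplied by a weight-zero series vanishing at `0`. -/
theorem lieDeriv_normalForm (f : Series 3) :
    lieDeriv (normalForm lam a₁ a₂ c) f =
      (C lam + PowerSeries.subst (X 1 * X 2 : Series 3) c) *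
          (X 2 * pderiv ℂ 2 f - X 1 * pderiv ℂ 1 f) +
        X 0 * (X 0 * pderiv ℂ 0 f + C a₁ * (X 1 * pderiv ℂ 1 f) +
          C a₂ * (X 2 * pderiv ℂ 2 f)) := by
  simp only [lieDeriv, normalForm, Fin.sum_univ_three, Matrix.cons_val_zero, Matrix.cons_val_one,
    Matrix.cons_val]
  ring

theorem coeff_weightDeriv (f : Series 3) (m : Fin 3 →₀ ℕ) :
    coeff m (X 2 * pderiv ℂ 2 f - X 1 * pderiv ℂ 1 f) = (weight m : ℂ) * coeff m f := by
  rw [map_sub, coeff_X_mul_pderiv, coeff_X_mul_pderiv, weight]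
  push_cast
  ring

theorem coeff_scaledEuler (f : Series 3) (m : Fin 3 →₀ ℕ) :
    coeff m (X 0 * pderiv ℂ 0 f + C a₁ * (X 1 * pderiv ℂ 1 f) + C a₂ * (X 2 * pderiv ℂ 2 f)) =
      (m 0 + a₁ * m 1 + a₂ * m 2) * coeff m f := by
  rw [map_add, map_add, coeff_C_mul, coeff_C_mul, coeff_X_mul_pderiv, coeff_X_mul_pderiv,
    coeff_X_mul_pderiv]
  ring

theorem isWeightHomogeneous_subst_mul (c : PowerSeries ℂ) :
    IsWeightHomogeneous 0 (PowerSeries.subst (X 1 * X 2 : Series 3) c) := by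
  refine IsWeightHomogeneous.subst ?_ (by simp) c
  simpa using IsWeightHomogeneous.X_one.mul IsWeightHomogeneous.X_two

/-- Modulo terms that raise the degree and preserve the weight, the equation reads `λ (H - s) f =
0`. Induction on the degree, within a fixed weight other than `s`, kills the coefficients one by
one. -/
theorem isWeightHomogeneous_of_lieDeriv (hlam : lam ≠ 0) (hc : PowerSeries.constantCoeff c = 0)
    {s : ℤ} {u f : Series 3} (hu : IsWeightHomogeneous 0 u) (hu0 : constantCoeff u = 0)
    (hf : lieDeriv (normalForm lam a₁ a₂ c) f = (C (s * lam) + u) * f) :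
    IsWeightHomogeneous s f := by
  suffices h : ∀ n : ℕ, ∀ m : Fin 3 →₀ ℕ, m.degree = n → weight m ≠ s → coeff m f = 0 by
    intro m hm
    by_contra hw
    exact hm (h _ m rfl hw)
  intro n
  induction n using Nat.strong_induction_on with
  | _ n ih =>
    intro m hm hw
    have low : ∀ e : Fin 3 →₀ ℕ, e.degree < m.degree → weight e = weight m → coeff e f = 0 :=
      fun e he hwe => ih _ (hm ▸ he) e rfl (hwe ▸ hw)
    have h := congrArg (coeff m) hf
    -- The terms with factors `u`, `c(v)` and `x` see only coefficients of lower degree and the same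
    -- weight, which vanish by induction.
    rw [lieDeriv_normalForm, add_mul, add_mul, map_add, map_add, map_add, coeff_C_mul,
      coeff_C_mul, coeff_weightDeriv, coeff_mul_eq_zero_of_lower hu hu0 low,
      coeff_mul_eq_zero_of_lower (isWeightHomogeneous_subst_mul c)
        (PowerSeries.constantCoeff_subst_eq_zero (by simp) c hc)
        (fun e he hwe => by rw [coeff_weightDeriv, low e he hwe, mul_zero]),
      coeff_mul_eq_zero_of_lower IsWeightHomogeneous.X_zero (by simp)
        (fun e he hwe => by rw [coeff_scaledEuler, low e he hwe, mul_zero])] at h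
    have h' : lam * (((weight m - s : ℤ) : ℂ) * coeff m f) = 0 := by
      push_cast
      linear_combination h
    refine (mul_eq_zero.1 ((mul_eq_zero.1 h').resolve_left hlam)).resolve_left ?_
    exact_mod_cast sub_ne_zero.2 hw

/-- On weight `s` the operator `H` is multiplication by `s`, so the `λ + c(v)` terms cancel.
Dividing by `x` leaves `E f = b f`, which can be read off monomial by monomial. -/
theorem coeff_of_lieDeriv {s : ℤ} {b : ℂ} {f : Series 3} (hs : IsWeightHomogeneous s f)
    (hf : lieDeriv (normalForm lam a₁ a₂ c) f =
      (C (s * lam) + (C (s : ℂ) * PowerSeries.subst (X 1 * X 2 : Series 3) c + C b * X 0)) * f)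
    (m : Fin 3 →₀ ℕ) : (m 0 + a₁ * m 1 + a₂ * m 2 - b) * coeff m f = 0 := by
  have hH : X 2 * pderiv ℂ 2 f - X 1 * pderiv ℂ 1 f = C (s : ℂ) * f := by
    ext e
    rw [coeff_weightDeriv, coeff_C_mul]
    by_cases he : coeff e f = 0
    · rw [he, mul_zero, mul_zero]
    · rw [hs e he]
  rw [lieDeriv_normalForm, hH, map_mul] at hf
  have hX : (X 0 : Series 3) * (X 0 * pderiv ℂ 0 f + C a₁ * (X 1 * pderiv ℂ 1 f) +
      C a₂ * (X 2 * pderiv ℂ 2 f)) = X 0 * (C b * f) := by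
    linear_combination hf
  have hX0 : (X 0 : Series 3) ≠ 0 := by
    intro h
    have := congrArg (coeff (Finsupp.single 0 1)) h
    rw [coeff_index_single_self_X, map_zero] at this
    exact one_ne_zero this
  have h := congrArg (coeff m) (mul_left_cancel₀ hX0 hX)
  rw [coeff_scaledEuler, coeff_C_mul] at h
  linear_combination h

end NormalForm


/-! ### The Jacobian determinant of a transversally symplectic diffeomorphism -/

/-- The coefficient of `dx ∧ dy₁ ∧ dy₂`, as a linear functional on forms. -/
noncomputable def volumeCoeff : Form 3 →ₗ[Series 3] Series 3 :=
  ExteriorAlgebra.liftAlternating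
    -- A linear functional on the exterior algebra is a family of alternating maps, one in each
    -- degree: here the determinant in degree `3` and zero in all others.
    (Function.update 0 3 (Matrix.detRowAlternating (n := Fin 3) (R := Series 3)))

theorem volumeCoeff_dSeries_mul (f g h : Series 3) :
    volumeCoeff (dSeries f * (dSeries g * dSeries h)) =
      Matrix.det (Matrix.of ![fun i => pderiv ℂ i f, fun i => pderiv ℂ i g,
        fun i => pderiv ℂ i h]) := by
  have : dSeries f * (dSeries g * dSeries h) = ExteriorAlgebra.ιMulti (Series 3) 3
      ![(fun i => pderiv ℂ i f : OneForm 3), fun i => pderiv ℂ i g, fun i => pderiv ℂ i h] := by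
    simp [ExteriorAlgebra.ιMulti_apply, dSeries]
  rw [this, volumeCoeff, ExteriorAlgebra.liftAlternating_apply_ιMulti, Function.update_self]
  rfl

/-- Wedging with `dx` annihilates `⟨dx⟩` and turns the symplectic condition into an equality of
`3`-forms. -/
theorem IsTransversallySymplectic.jacobian {Φ : FormalDiffeo 3}
    (hΦ : IsTransversallySymplectic Φ) :
    pderiv ℂ 1 (Φ.comp 1) * pderiv ℂ 2 (Φ.comp 2) -
      pderiv ℂ 2 (Φ.comp 1) * pderiv ℂ 1 (Φ.comp 2) = 1 := by
  obtain ⟨-, η, hη⟩ := hΦ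
  have h0 : dSeries (X 0) * (pullback Φ dy₁dy₂ - dy₁dy₂) = 0 := by
    rw [hη, ← mul_assoc, dSeries, ExteriorAlgebra.ι_sq_zero, zero_mul]
  rw [mul_sub, sub_eq_zero, dy₁dy₂, map_mul, pullback_dSeries, pullback_dSeries,
    FormalDiffeo.pullbackSeries_X, FormalDiffeo.pullbackSeries_X] at h0
  have h := congrArg volumeCoeff h0
  rw [volumeCoeff_dSeries_mul, volumeCoeff_dSeries_mul, Matrix.det_fin_three,
    Matrix.det_fin_three] at h
  -- The row of `dx` is `(1, 0, 0)`, so each determinant reduces to its minor in the `y` variables.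
  simpa [pderiv_X] using h

/-! ### Low-order coefficients -/

theorem coeff_single_eq_constantCoeff_pderiv (f : Series 3) (i : Fin 3) :
    coeff (Finsupp.single i 1) f = constantCoeff (pderiv ℂ i f) := by
  rw [← coeff_zero_eq_constantCoeff_apply, coeff_pderiv]
  simp

theorem coeff_single_mul_eq_zero {f g : Series 3} (hf : constantCoeff f = 0)
    (hg : constantCoeff g = 0) (i : Fin 3) : coeff (Finsupp.single i 1) (f * g) = 0 := by
  rw [coeff_single_eq_constantCoeff_pderiv, Derivation.leibniz]
  simp [hf, hg]

theorem coeff_single_add_single_mul {f g : Series 3} (hf : constantCoeff f = 0)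
    (hg : constantCoeff g = 0) {i j : Fin 3} (hij : i ≠ j) :
    coeff (Finsupp.single i 1 + Finsupp.single j 1) (f * g) =
      coeff (Finsupp.single i 1) f * coeff (Finsupp.single j 1) g +
        coeff (Finsupp.single j 1) f * coeff (Finsupp.single i 1) g := by
  -- As `i ≠ j`, the mixed derivative introduces no factorial.
  have h : coeff (Finsupp.single i 1 + Finsupp.single j 1) (f * g) =
      constantCoeff (pderiv ℂ i (pderiv ℂ j (f * g))) := by
    rw [← coeff_zero_eq_constantCoeff_apply, coeff_pderiv, coeff_pderiv]
    simp [Finsupp.single_eq_of_ne hij.symm]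
  rw [h]
  simp only [Derivation.leibniz, map_add, smul_eq_mul, map_mul, hf, hg,
    coeff_single_eq_constantCoeff_pderiv]
  ring

theorem eq_C_mul_X_of_coeff {f : Series 3} {i : Fin 3}
    (h : ∀ m, coeff m f ≠ 0 → m = Finsupp.single i 1) :
    f = C (coeff (Finsupp.single i 1) f) * X i := by
  classical
  ext m
  rw [coeff_C_mul, coeff_X]
  split_ifs with hm
  · rw [hm, mul_one]
  · rw [mul_zero]
    by_contra hne
    exact hm (h m hne)

theorem finsupp_fin_three_ext {m e : Fin 3 →₀ ℕ} (h0 : m 0 = e 0) (h1 : m 1 = e 1)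
    (h2 : m 2 = e 2) : m = e := by
  ext i
  fin_cases i
  exacts [h0, h1, h2]

/-! ### Diagonal isotropies -/

theorem diag_comp {n : ℕ} (d : Fin n → ℂˣ) (i : Fin n) :
    (FormalDiffeo.diag d).comp i = C (d i : ℂ) * X i := rfl

theorem pullbackSeries_C {n : ℕ} (Φ : FormalDiffeo n) (z : ℂ) :
    Φ.pullbackSeries (C z) = C z := by
  rw [FormalDiffeo.pullbackSeries_apply, subst_C]

theorem diag_mul {n : ℕ} (d e : Fin n → ℂˣ) :
    FormalDiffeo.diag (d * e) = FormalDiffeo.diag d * FormalDiffeo.diag e := by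
  ext1
  funext i
  rw [FormalDiffeo.mul_comp, diag_comp, diag_comp, map_mul, pullbackSeries_C,
    FormalDiffeo.pullbackSeries_X, diag_comp, Pi.mul_apply, Units.val_mul, map_mul, mul_assoc]

theorem diag_injective {n : ℕ} :
    Function.Injective (FormalDiffeo.diag : (Fin n → ℂˣ) → FormalDiffeo n) := by
  intro d e h
  funext i
  have h' := congrArg (fun Φ : FormalDiffeo n => coeff (Finsupp.single i 1) (Φ.comp i)) h
  simp only [diag_comp, coeff_C_mul, coeff_index_single_self_X, mul_one] at h'
  exact Units.ext h'

theorem dSeries_C_mul {n : ℕ} (z : ℂ) (f : Series n) : dSeries (C z * f) = (C z : Series n) • dSeries f := by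
  rw [dSeries, dSeries, ← map_smul]
  congr 1
  funext i
  simp [Derivation.leibniz, pderiv_C]

theorem C_mul_C_inv {n : ℕ} (α : ℂˣ) : (C (α : ℂ) * C ((α⁻¹ : ℂˣ) : ℂ) : Series n) = 1 := by
  rw [← map_mul, Units.mul_inv, map_one]

theorem isTransversallySymplectic_diag (α : ℂˣ) :
    IsTransversallySymplectic (FormalDiffeo.diag ![1, α, α⁻¹]) := by
  refine ⟨by simp [diag_comp], 0, ?_⟩
  rw [mul_zero, sub_eq_zero, dy₁dy₂, map_mul, pullback_dSeries, pullback_dSeries,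
    FormalDiffeo.pullbackSeries_X, FormalDiffeo.pullbackSeries_X, diag_comp, diag_comp,
    dSeries_C_mul, dSeries_C_mul, smul_mul_smul_comm]
  simp only [Matrix.cons_val_one, Matrix.cons_val_zero, Matrix.cons_val]
  rw [C_mul_C_inv, one_smul]

theorem lieDeriv_C_mul_X {n : ℕ} (Y : VectorField n) (z : ℂ) (i : Fin n) :
    lieDeriv Y (C z * X i) = C z * Y i := by
  classical
  simp [lieDeriv, Derivation.leibniz, pderiv_C, pderiv_X, Pi.single_apply,
    Finset.sum_ite_eq]

section NormalForm

variable {lam a₁ a₂ : ℂ} {c : PowerSeries ℂ}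

theorem normalForm_zero : normalForm lam a₁ a₂ c 0 = X 0 ^ 2 := rfl

theorem normalForm_one : normalForm lam a₁ a₂ c 1 =
    (-(C lam + PowerSeries.subst (X 1 * X 2 : Series 3) c) + C a₁ * X 0) * X 1 := rfl

theorem normalForm_two : normalForm lam a₁ a₂ c 2 =
    (C lam + PowerSeries.subst (X 1 * X 2 : Series 3) c + C a₂ * X 0) * X 2 := rfl

theorem diag_mem_isotropyGroup (α : ℂˣ) :
    FormalDiffeo.diag ![1, α, α⁻¹] ∈ isotropyGroup (normalForm lam a₁ a₂ c) := by
  refine ⟨isTransversallySymplectic_diag α, (pushForward_eq_self_iff _ _).2 fun i => ?_⟩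
  set Φ := FormalDiffeo.diag ![1, α, α⁻¹] with hΦ
  have h0 : Φ.comp 0 = X 0 := by simp [hΦ, diag_comp]
  have h1 : Φ.comp 1 = C (α : ℂ) * X 1 := rfl
  have h2 : Φ.comp 2 = C ((α⁻¹ : ℂˣ) : ℂ) * X 2 := rfl
  -- Invariance of `v` gives that of `c(v)`; the components of `Z` are then linear in `y₁` and `y₂`
  -- over invariant series.
  have hv : Φ.pullbackSeries (X 1 * X 2) = X 1 * X 2 := by
    rw [map_mul, FormalDiffeo.pullbackSeries_X, FormalDiffeo.pullbackSeries_X, h1, h2]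
    linear_combination (X 1 * X 2 : Series 3) * C_mul_C_inv α
  have hcv : Φ.pullbackSeries (PowerSeries.subst (X 1 * X 2 : Series 3) c) =
      PowerSeries.subst (X 1 * X 2 : Series 3) c := by
    rw [pullbackSeries_powerSeries_subst _ (by simp), hv]
  rw [show Φ.comp i = C ((![1, α, α⁻¹] i : ℂˣ) : ℂ) * X i from rfl, lieDeriv_C_mul_X]
  fin_cases i
  · simp [normalForm_zero, h0]
  · change C (α : ℂ) * normalForm lam a₁ a₂ c 1 = Φ.pullbackSeries (normalForm lam a₁ a₂ c 1)
    simp only [normalForm_one, map_mul, map_add, map_neg, hcv, pullbackSeries_C,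
      FormalDiffeo.pullbackSeries_X, h0, h1]
    ring
  · change C ((α⁻¹ : ℂˣ) : ℂ) * normalForm lam a₁ a₂ c 2 =
      Φ.pullbackSeries (normalForm lam a₁ a₂ c 2)
    simp only [normalForm_two, map_mul, map_add, hcv, pullbackSeries_C,
      FormalDiffeo.pullbackSeries_X, h0, h2]
    ring

/-! ### Every isotropy is diagonal -/

theorem exists_eq_diag_of_mem_isotropyGroup (hlam : lam ≠ 0) (ha : a₁ + a₂ = 1)
    (hc : PowerSeries.constantCoeff c = 0) {Φ : FormalDiffeo 3}
    (hΦ : Φ ∈ isotropyGroup (normalForm lam a₁ a₂ c)) :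
    ∃ α : ℂˣ, FormalDiffeo.diag ![1, α, α⁻¹] = Φ := by
  obtain ⟨hs, hZ⟩ : IsTransversallySymplectic Φ ∧ _ := hΦ
  rw [pushForward_eq_self_iff] at hZ
  have hx : Φ.comp 0 = X 0 := by rw [← FormalDiffeo.pullbackSeries_X, hs.1]
  set f := Φ.comp 1 with hf
  set g := Φ.comp 2 with hg
  have hf0 : constantCoeff f = 0 := Φ.constantCoeff_comp 1
  have hg0 : constantCoeff g = 0 := Φ.constantCoeff_comp 2
  have hw0 : constantCoeff (f * g) = 0 := by rw [map_mul, hf0, zero_mul]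
  have hcw : Φ.pullbackSeries (PowerSeries.subst (X 1 * X 2 : Series 3) c) =
      PowerSeries.subst (f * g) c := by
    rw [pullbackSeries_powerSeries_subst _ (by simp), map_mul, FormalDiffeo.pullbackSeries_X,
      FormalDiffeo.pullbackSeries_X]
  have hZf := hZ 1
  have hZg := hZ 2
  simp only [normalForm_one, normalForm_two, map_mul, map_add, map_neg, hcw, pullbackSeries_C,
    FormalDiffeo.pullbackSeries_X, hx, ← hf, ← hg] at hZf hZg
  have hC : (C a₁ + C a₂ : Series 3) = 1 := by rw [← map_add, ha, map_one]
  -- The product has to come before its factors: their equations contain `c(fg)`, whose weight is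
  -- not yet known, whereas here it cancels.
  have hZw : lieDeriv (normalForm lam a₁ a₂ c) (f * g) = X 0 * (f * g) := by
    rw [lieDeriv_mul, hZf, hZg]
    linear_combination X 0 * f * g * hC
  have hw : IsWeightHomogeneous 0 (f * g) :=
    isWeightHomogeneous_of_lieDeriv hlam hc IsWeightHomogeneous.X_zero (by simp)
      (by rw [hZw]; simp)
  have hu := hw.subst hw0 c
  have hu0 := PowerSeries.constantCoeff_subst_eq_zero hw0 c hc
  have hwf : IsWeightHomogeneous (-1) f := by
    refine isWeightHomogeneous_of_lieDeriv (a₁ := a₁) (a₂ := a₂) hlam hc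
      ((hu.C_mul (-1)).add (IsWeightHomogeneous.X_zero.C_mul a₁)) (by simp [hu0]) ?_
    rw [hZf]
    simp only [Int.cast_neg, Int.cast_one, map_neg, map_one, map_mul]
    ring
  have hwg : IsWeightHomogeneous 1 g := by
    refine isWeightHomogeneous_of_lieDeriv (a₁ := a₁) (a₂ := a₂) hlam hc
      (hu.add (IsWeightHomogeneous.X_zero.C_mul a₂)) (by simp [hu0]) ?_
    rw [hZg]
    simp only [Int.cast_one, map_one, map_mul]
    ring
  -- The monomial `y₂` has weight `1`, not `-1`; this removes the off-diagonal product from the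
  -- Jacobian at `0`.
  have hf2 : coeff (Finsupp.single 2 1) f = 0 := hwf.coeff_eq_zero (by simp [weight])
  have hdet : coeff (Finsupp.single 1 1) f * coeff (Finsupp.single 2 1) g = 1 := by
    have h := congrArg constantCoeff hs.jacobian
    simp only [map_sub, map_mul, ← coeff_single_eq_constantCoeff_pderiv, ← hf, ← hg, hf2,
      zero_mul, sub_zero, map_one] at h
    exact h
  have hwv : f * g = X 1 * X 2 := by
    have hv : (X 1 * X 2 : Series 3) = monomial (Finsupp.single 1 1 + Finsupp.single 2 1) 1 := by
      rw [X, X, monomial_mul_monomial, one_mul]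
    classical
    ext m
    rw [hv, coeff_monomial]
    split_ifs with hm
    · rw [hm, coeff_single_add_single_mul hf0 hg0 (by decide), hf2, zero_mul, add_zero, hdet]
    · by_contra hne
      have h := (mul_eq_zero.1 (coeff_of_lieDeriv (b := 1) hw
        (by rw [hZw]; simp) m)).resolve_right hne
      have h12 : m 2 = m 1 := by
        have := hw m hne
        rw [weight] at this
        omega
      -- With `m 2 = m 1` and `a₁ + a₂ = 1` the `E`-eigenvalue is the integer `m 0 + m 1`; only `x`
      -- and `y₁y₂` remain.
      have h01 : m 0 + m 1 = 1 := by
        rw [h12] at h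
        have : (m 0 + m 1 : ℂ) = 1 := by linear_combination h - (m 1 : ℂ) * ha
        exact_mod_cast this
      rcases Nat.eq_zero_or_pos (m 1) with h1 | h1
      · refine hne ?_
        have : m = Finsupp.single 0 1 := by
          refine finsupp_fin_three_ext ?_ ?_ ?_ <;> simp <;> omega
        rw [this, coeff_single_mul_eq_zero hf0 hg0]
      · refine hm (finsupp_fin_three_ext ?_ ?_ ?_) <;> simp <;> omega
  -- Now `c(fg)` is `c(v)`, as `coeff_of_lieDeriv` requires.
  rw [hwv] at hZf hZg
  have hfX := eq_C_mul_X_of_coeff (f := f) (i := 1) fun m hne => by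
    have h := (mul_eq_zero.1 (coeff_of_lieDeriv (b := a₁) hwf
      (by
        rw [hZf]
        simp only [Int.cast_neg, Int.cast_one, map_neg, map_one, map_mul]
        ring) m)).resolve_right hne
    have h12 : m 1 = m 2 + 1 := by
      have := hwf m hne
      rw [weight] at this
      omega
    -- Substituting `m 1 = m 2 + 1`, the eigenvalue `a₁` cancels, and a sum of two naturals is left
    -- equal to zero.
    have h02 : m 0 + m 2 = 0 := by
      rw [h12] at h
      push_cast at h
      have : (m 0 + m 2 : ℂ) = 0 := by linear_combination h - (m 2 : ℂ) * ha
      exact_mod_cast this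
    refine finsupp_fin_three_ext ?_ ?_ ?_ <;> simp <;> omega
  have hgX := eq_C_mul_X_of_coeff (f := g) (i := 2) fun m hne => by
    have h := (mul_eq_zero.1 (coeff_of_lieDeriv (b := a₂) hwg
      (by
        rw [hZg]
        simp only [Int.cast_one, map_one, map_mul]
        ring) m)).resolve_right hne
    have h12 : m 2 = m 1 + 1 := by
      have := hwg m hne
      rw [weight] at this
      omega
    have h01 : m 0 + m 1 = 0 := by
      rw [h12] at h
      push_cast at h
      have : (m 0 + m 1 : ℂ) = 0 := by linear_combination h - (m 1 : ℂ) * ha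
      exact_mod_cast this
    refine finsupp_fin_three_ext ?_ ?_ ?_ <;> simp <;> omega
  -- The unit `α` is the `y₁` coefficient of `f`; by `hdet` its inverse is the `y₂` coefficient of
  -- `g`.
  refine ⟨⟨_, _, hdet, by rw [mul_comm, hdet]⟩, ?_⟩
  ext1
  funext i
  rw [diag_comp]
  fin_cases i
  · simp [hx]
  · exact hfX.symm
  · exact hgX.symm

/-- `α ↦ diag(1, α, α⁻¹)` as a homomorphism into the isotropy group of the normal form. -/
noncomputable def diagIsotropy (lam a₁ a₂ : ℂ) (c : PowerSeries ℂ) :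
    ℂˣ →* isotropyGroup (normalForm lam a₁ a₂ c) :=
  MonoidHom.mk' (fun α => ⟨FormalDiffeo.diag ![1, α, α⁻¹], diag_mem_isotropyGroup α⟩)
    fun α β => Subtype.ext <| by
      rw [Subgroup.coe_mul, ← diag_mul]
      refine congrArg FormalDiffeo.diag (funext fun i => ?_)
      fin_cases i <;> simp [mul_comm]

theorem diagIsotropy_injective : Function.Injective (diagIsotropy lam a₁ a₂ c) := fun α β h => by
  have : (![1, α, α⁻¹] : Fin 3 → ℂˣ) = ![1, β, β⁻¹] := diag_injective (congrArg Subtype.val h)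
  exact congrFun this 1

theorem diagIsotropy_surjective (hlam : lam ≠ 0) (ha : a₁ + a₂ = 1)
    (hc : PowerSeries.constantCoeff c = 0) :
    Function.Surjective (diagIsotropy lam a₁ a₂ c) := fun Φ => by
  obtain ⟨α, hα⟩ := exists_eq_diag_of_mem_isotropyGroup hlam ha hc Φ.2
  exact ⟨α, Subtype.ext hα⟩

end NormalForm

end FormalGeometry

theorem mainTheorem8 (lam a₁ a₂ : ℂ) (hlam : lam ≠ 0) (ha : a₁ + a₂ = 1)
    (c : PowerSeries ℂ) (hc : PowerSeries.constantCoeff c = 0) :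
    (FormalGeometry.isotropyGroup (FormalGeometry.normalForm lam a₁ a₂ c) :
        Set (FormalGeometry.FormalDiffeo 3)) =
      Set.range (fun α : ℂˣ => FormalGeometry.FormalDiffeo.diag ![1, α, α⁻¹]) ∧
    ∃ e : ℂˣ ≃* FormalGeometry.isotropyGroup (FormalGeometry.normalForm lam a₁ a₂ c),
      ∀ α : ℂˣ, (e α : FormalGeometry.FormalDiffeo 3) =
        FormalGeometry.FormalDiffeo.diag ![1, α, α⁻¹] := by
  refine ⟨Set.Subset.antisymm
    (fun Φ hΦ => FormalGeometry.exists_eq_diag_of_mem_isotropyGroup hlam ha hc hΦ) ?_,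
    MulEquiv.ofBijective (FormalGeometry.diagIsotropy lam a₁ a₂ c)
      ⟨FormalGeometry.diagIsotropy_injective,
        FormalGeometry.diagIsotropy_surjective hlam ha hc⟩, fun α => rfl⟩
  rintro _ ⟨α, rfl⟩
  exact FormalGeometry.diag_mem_isotropyGroup α
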